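/- For $n\ge 1$ let $S_n$ be the set of all permutations of $\{1,\dots,n\}$. For $\rho,\pi\in S_n$ the Kendall $\tau$-distance $d_K(\rho,\pi)$ is the minimum number of adjacent transpositions $(i,i+1)$, $1\le i\le n-1$, needed to write $\rho\pi^{-1}$ as their product, where permutations are multiplied from left to right, i.e. $(\lambda\cdot\sigma)(i)=\sigma(\lambda(i))$. Equivalently, $d_K(\rho,\pi)$ is the minimum number of swaps of neighbouring entries that transform $[\pi(1),\dots,\pi(n)]$ into $[\rho(1),\dots,\rho(n)]$. Let $P(n,d)$ be the maximum size of a non-empty subset $C\subseteq S_n$ such that $d_K(\rho,\pi)\ge d$ for any two distinct $\rho,\pi\in C$. **Theorem.** $$P(6,3)\le 116,\qquad P(7,3)\le 716,\qquad P(11,3)\le 10!-10,\qquad P(13,3)\le 12!-12,\qquad P(17,3)\le 16!-5 .$$ -/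

import Mathlib

/-- An adjacent transposition `(i, i + 1)` of the ordered set `Fin n`
(which plays the role of `{1, …, n}`). -/
def IsAdjacentTransposition {n : ℕ} (s : Equiv.Perm (Fin n)) : Prop :=
  ∃ i j : Fin n, (i : ℕ) + 1 = (j : ℕ) ∧ s = Equiv.swap i j

/-- `ρ` and `π` differ by a product of exactly `k` adjacent transpositions. Permutations are
multiplied from left to right in the source (`(ρ · π⁻¹) i = π⁻¹ (ρ i)`), whereas `*` on
`Equiv.Perm` is `(f * g) i = f (g i)`; so `ρ · π⁻¹` is `π⁻¹ * ρ` here. Equivalently, `ρ` is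
obtained from `[π(1), …, π(n)]` by `k` successive swaps of entries in neighbouring positions. -/
def IsAdjacentProduct {n : ℕ} (ρ π : Equiv.Perm (Fin n)) (k : ℕ) : Prop :=
  ∃ l : List (Equiv.Perm (Fin n)),
    (∀ s ∈ l, IsAdjacentTransposition s) ∧ l.prod = π⁻¹ * ρ ∧ l.length = k

/-- The Kendall `τ`-distance: the least number of adjacent transpositions needed to pass from
`π` to `ρ`. The minimum is over a nonempty set, see `kendallDist_spec`. -/
noncomputable def kendallDist {n : ℕ} (ρ π : Equiv.Perm (Fin n)) : ℕ :=
  sInf {k : ℕ | IsAdjacentProduct ρ π k}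

/-- The minimum defining the Kendall `τ`-distance is attained. -/
theorem kendallDist_spec {n : ℕ} (ρ π : Equiv.Perm (Fin n)) :
    IsAdjacentProduct ρ π (kendallDist ρ π) := by
  have hne : {k : ℕ | IsAdjacentProduct ρ π k}.Nonempty := by
    cases n with
    | zero => exact ⟨0, [], by simp, Subsingleton.elim _ _, rfl⟩
    | succ m =>
      have hmem : π⁻¹ * ρ ∈ Submonoid.closure
          (Set.range fun i : Fin m => Equiv.swap i.castSucc i.succ) := by
        rw [Equiv.Perm.mclosure_swap_castSucc_succ]
        exact Submonoid.mem_top _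
      obtain ⟨l, hl, hprod⟩ := Submonoid.exists_list_of_mem_closure hmem
      refine ⟨l.length, l, fun s hs => ?_, hprod, rfl⟩
      obtain ⟨i, rfl⟩ := hl s hs
      exact ⟨i.castSucc, i.succ, by simp, rfl⟩
  exact Nat.sInf_mem hne

/-- A permutation code of length `n` with minimum Kendall `τ`-distance at least `d`: a nonempty
set of permutations, any two distinct members of which are at distance at least `d`. -/
def IsPermutationCode (n d : ℕ) (C : Finset (Equiv.Perm (Fin n))) : Prop :=
  C.Nonempty ∧ ∀ ρ ∈ C, ∀ π ∈ C, ρ ≠ π → d ≤ kendallDist ρ π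

/-- `P(n, d)`: the maximum size of a permutation code of length `n` with minimum Kendall
`τ`-distance at least `d`. It is a genuine maximum, see `maxCodeSize_isGreatest`. -/
noncomputable def maxCodeSize (n d : ℕ) : ℕ :=
  sSup {k : ℕ | ∃ C : Finset (Equiv.Perm (Fin n)), IsPermutationCode n d C ∧ C.card = k}

/-- The maximum defining `P(n, d)` exists and is attained. -/
theorem maxCodeSize_isGreatest (n d : ℕ) :
    IsGreatest {k : ℕ | ∃ C : Finset (Equiv.Perm (Fin n)), IsPermutationCode n d C ∧ C.card = k}
      (maxCodeSize n d) := by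
  have hbdd : BddAbove
      {k : ℕ | ∃ C : Finset (Equiv.Perm (Fin n)), IsPermutationCode n d C ∧ C.card = k} := by
    refine ⟨Fintype.card (Equiv.Perm (Fin n)), ?_⟩
    rintro k ⟨C, -, rfl⟩
    exact Finset.card_le_univ C
  refine ⟨Nat.sSup_mem ⟨1, {1}, ⟨Finset.singleton_nonempty 1, ?_⟩, by simp⟩ hbdd,
    fun k hk => le_csSup hbdd hk⟩
  intro ρ hρ π hπ hne
  rw [Finset.mem_singleton] at hρ hπ
  exact absurd (hρ.trans hπ.symm) hne

/-! When the minimum distance is at least 3, the balls of radius one about the codewords, each of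
size `n`, are disjoint. This packing is counted inside classes of permutations with prescribed
values at prescribed positions: right multiplication by an adjacent transposition permutes
positions, so each class yields a linear inequality between integer codeword counts at neighbouring
positions (`card_filter_eq`, `sum_card_le`).

Prime `p`: let `x` count the codewords taking the values 0 and 1 at a given ordered pair of
positions. The counts over a ball sum to at most `(p - 2)!`, which is `1 + p * c` by Wilson, so `c -
x` has ball sums at least `-1`. A pair of positions is moved by at most four generators, and for `p
≥ 9` discharging (`sum_nonneg_of_orbit_sums`) gives `#C ≤ p * (p - 1) * c = (p - 1)! - (p - 1)`.

Length 6: a finite search shows that if some codeword has last entry `u`, at least two permutations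
with last entry `u` are uncovered (`two_le_card_uncovered`). For a code of size 117 this sharpens
the inequality at the last position for every `u`, and summing over `u` is contradictory.

Length 7: the classes are also split by sign, since a ball consists of its centre and six
permutations of the opposite sign. For size 717 the resulting system forces each value to occur at
the middle position at least 103 times (`middle_neg`), but `7 * 103 > 717`. -/

namespace KendallCode

open Finset Equiv

/-! ### Balls of radius one and their packing -/

/-- The identity (index `0`) followed by the adjacent transpositions. -/
def adj (m : ℕ) : Fin (m + 1) → Perm (Fin (m + 1)) :=
  Fin.cases 1 fun i => swap i.castSucc i.succ

@[simp] theorem adj_zero (m : ℕ) : adj m 0 = 1 := rfl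

@[simp] theorem adj_succ (m : ℕ) (i : Fin m) : adj m i.succ = swap i.castSucc i.succ := rfl

theorem adj_mul_self (m : ℕ) (k : Fin (m + 1)) : adj m k * adj m k = 1 := by
  cases k using Fin.cases <;> simp

theorem adj_injective (m : ℕ) : Function.Injective (adj m) := by
  have key : ∀ i j : Fin m, swap i.castSucc i.succ = swap j.castSucc j.succ → i = j := by
    intro i j h
    have h1 := congrArg (fun f : Perm (Fin (m + 1)) => ((f i.castSucc : Fin (m + 1)) : ℕ)) h
    have h2 := congrArg (fun f : Perm (Fin (m + 1)) => ((f i.succ : Fin (m + 1)) : ℕ)) h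
    simp only [swap_apply_left, swap_apply_right, swap_apply_def, Fin.ext_iff,
      Fin.val_castSucc, Fin.val_succ] at h1 h2
    split_ifs at h1 h2 <;> simp at h1 h2 <;> omega
  have key' : ∀ i : Fin m, swap i.castSucc i.succ ≠ 1 := by
    intro i h
    have h1 := congrArg (fun f : Perm (Fin (m + 1)) => ((f i.castSucc : Fin (m + 1)) : ℕ)) h
    simp at h1
  intro k l h
  cases k using Fin.cases with
  | zero =>
    cases l using Fin.cases with
    | zero => rfl
    | succ j => exact absurd h.symm (key' j)
  | succ i =>
    cases l using Fin.cases with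
    | zero => exact absurd h (key' i)
    | succ j => rw [key i j h]

theorem exists_list_adj (m : ℕ) (k : Fin (m + 1)) :
    ∃ l : List (Perm (Fin (m + 1))), (∀ s ∈ l, IsAdjacentTransposition s) ∧
      l.prod = adj m k ∧ l.length ≤ 1 := by
  cases k using Fin.cases with
  | zero => exact ⟨[], by simp, by simp, by simp⟩
  | succ i =>
    refine ⟨[swap i.castSucc i.succ], ?_, by simp, by simp⟩
    intro s hs
    rw [List.mem_singleton] at hs
    exact ⟨i.castSucc, i.succ, by simp, hs⟩

/-- Two distinct centres of balls with a common point would be joined by at most two adjacent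
transpositions, against distance at least 3. -/
theorem eq_of_mul_adj_eq {m : ℕ} {C : Finset (Perm (Fin (m + 1)))}
    (hC : IsPermutationCode (m + 1) 3 C) {π ρ : Perm (Fin (m + 1))} (hπ : π ∈ C) (hρ : ρ ∈ C)
    {k l : Fin (m + 1)} (h : π * adj m k = ρ * adj m l) : π = ρ ∧ k = l := by
  have hπρ : π = ρ := by
    by_contra hne
    obtain ⟨l₁, h₁, p₁, n₁⟩ := exists_list_adj m l
    obtain ⟨l₂, h₂, p₂, n₂⟩ := exists_list_adj m k
    have hprod : IsAdjacentProduct π ρ (l₁ ++ l₂).length := by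
      refine ⟨l₁ ++ l₂, ?_, ?_, rfl⟩
      · intro s hs
        rcases List.mem_append.1 hs with hs | hs
        exacts [h₁ s hs, h₂ s hs]
      · rw [List.prod_append, p₁, p₂, eq_inv_mul_iff_mul_eq, ← mul_assoc, ← h, mul_assoc,
          adj_mul_self, mul_one]
    have hle : kendallDist π ρ ≤ (l₁ ++ l₂).length := Nat.sInf_le hprod
    have := hC.2 π hπ ρ hρ hne
    rw [List.length_append] at hle
    omega
  subst hπρ
  exact ⟨rfl, adj_injective m (mul_left_cancel h)⟩

/-- The permutations outside all balls of radius one centred at the code. -/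
def uncovered {m : ℕ} (C : Finset (Perm (Fin (m + 1)))) : Finset (Perm (Fin (m + 1))) :=
  {σ | ∀ π ∈ C, ∀ k, π * adj m k ≠ σ}

/-- The balls of radius one partition the covered permutations. -/
theorem card_filter_eq {m : ℕ} {C : Finset (Perm (Fin (m + 1)))}
    (hC : IsPermutationCode (m + 1) 3 C) (T : Perm (Fin (m + 1)) → Prop) [DecidablePred T] :
    #{σ | T σ} = ∑ k, #{π ∈ C | T (π * adj m k)} + #{σ ∈ uncovered C | T σ} := by
  classical
  have h1 : ({σ | T σ} : Finset (Perm (Fin (m + 1)))) =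
      (univ.biUnion fun k => ({π ∈ C | T (π * adj m k)}).image (· * adj m k)) ∪
        {σ ∈ uncovered C | T σ} := by
    ext σ
    simp only [mem_filter, mem_univ, true_and, mem_union, mem_biUnion, mem_image, uncovered]
    constructor
    · intro hσ
      by_cases hu : ∀ π ∈ C, ∀ k, π * adj m k ≠ σ
      · exact Or.inr ⟨hu, hσ⟩
      · push Not at hu
        obtain ⟨π, hπ, k, rfl⟩ := hu
        exact Or.inl ⟨k, π, ⟨hπ, hσ⟩, rfl⟩
    · rintro (⟨k, π, ⟨-, h⟩, rfl⟩ | ⟨-, h⟩) <;> exact h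
  rw [h1, card_union_of_disjoint, card_biUnion]
  · congr 1
    refine sum_congr rfl fun k _ => ?_
    exact card_image_of_injective _ (mul_left_injective _)
  · intro k _ l _ hkl
    rw [Function.onFun, disjoint_left]
    intro σ hk hl
    simp only [mem_image, mem_filter] at hk hl
    obtain ⟨π, ⟨hπ, -⟩, rfl⟩ := hk
    obtain ⟨ρ, ⟨hρ, -⟩, h⟩ := hl
    exact hkl (eq_of_mul_adj_eq hC hπ hρ h.symm).2
  · rw [disjoint_left]
    intro σ hk hu
    simp only [mem_biUnion, mem_image, mem_filter, uncovered, mem_univ, true_and] at hk hu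
    obtain ⟨k, π, ⟨hπ, -⟩, rfl⟩ := hk
    exact hu.1 π hπ k rfl

theorem sum_card_le {m : ℕ} {C : Finset (Perm (Fin (m + 1)))}
    (hC : IsPermutationCode (m + 1) 3 C) (T : Perm (Fin (m + 1)) → Prop) [DecidablePred T] :
    ∑ k, #{π ∈ C | T (π * adj m k)} ≤ #{σ | T σ} := by
  rw [card_filter_eq hC T]
  exact Nat.le_add_right _ _

theorem isPermutationCode_subset {n d : ℕ} {C D : Finset (Perm (Fin n))}
    (hC : IsPermutationCode n d C) (hDC : D ⊆ C) (hD : D.Nonempty) : IsPermutationCode n d D :=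
  ⟨hD, fun ρ hρ π hπ h => hC.2 ρ (hDC hρ) π (hDC hπ) h⟩

theorem maxCodeSize_le {n d N : ℕ}
    (h : ∀ C : Finset (Perm (Fin n)), IsPermutationCode n d C → #C ≤ N) : maxCodeSize n d ≤ N := by
  obtain ⟨C, hC, hcard⟩ := (maxCodeSize_isGreatest n d).1
  exact hcard ▸ h C hC

/-- Nonempty subsets of codes are codes, so excluding a single size excludes all larger ones. The
counting below can then work with an exact cardinality. -/
theorem maxCodeSize_le_of_ne {n d N : ℕ}
    (h : ∀ C : Finset (Perm (Fin n)), IsPermutationCode n d C → #C ≠ N + 1) :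
    maxCodeSize n d ≤ N := by
  refine maxCodeSize_le fun C hC => ?_
  by_contra! hlt
  obtain ⟨D, hDC, hD⟩ := exists_subset_card_eq (Nat.succ_le_of_lt hlt)
  exact h D (isPermutationCode_subset hC hDC (card_pos.1 (by omega))) hD

/-! ### Prime length: discharging and pairs of positions -/

/-- A discharging argument: if permutations `a k` of `ι` move each point for at most `D` of the
indices `k`, and there are more than `2 * D` indices, then an integer function all of whose
orbit sums are at least `-1` has nonnegative total. -/
theorem sum_nonneg_of_orbit_sums {ι κ : Type*} [Fintype ι] [DecidableEq ι] [Fintype κ]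
    (a : κ → Perm ι) (z : ι → ℤ) (D : ℕ) (hD : 0 < D) (hK : 2 * D + 1 ≤ Fintype.card κ)
    (hdeg : ∀ p, #{k | a k p ≠ p} ≤ D) (hz : ∀ p, -1 ≤ ∑ k, z (a k p)) : 0 ≤ ∑ p, z p := by
  set q : ι → ℤ := fun p => max (z p) 0 with hq
  set μ : ι → ℤ := fun p => max (-z p) 0 with hμ
  have hzq : ∀ p, z p = q p - μ p := by
    intro p
    simp only [hq, hμ]
    omega
  have hq0 : ∀ p, 0 ≤ q p := fun p => le_max_right _ _
  have hlocal : ∀ p, (D : ℤ) * μ p ≤ ∑ k with a k p ≠ p, q (a k p) := by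
    intro p
    rcases le_or_gt 0 (z p) with hp | hp
    · have : μ p = 0 := by simp only [hμ]; omega
      rw [this, mul_zero]
      exact sum_nonneg fun k _ => hq0 _
    · have hμp : μ p = -z p := by simp only [hμ]; omega
      have h1 := hz p
      rw [← sum_filter_add_sum_filter_not univ (fun k => a k p ≠ p)] at h1
      have h2 : ∑ k with ¬ a k p ≠ p, z (a k p) = #{k | ¬ a k p ≠ p} * z p := by
        rw [← nsmul_eq_mul, ← sum_const]
        refine sum_congr rfl fun k hk => ?_
        rw [not_not.1 (mem_filter.1 hk).2]
      have h3 : ∑ k with a k p ≠ p, z (a k p) ≤ ∑ k with a k p ≠ p, q (a k p) :=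
        sum_le_sum fun k _ => le_max_left _ _
      have h4 : #{k | a k p ≠ p} + #{k | ¬ a k p ≠ p} = Fintype.card κ := by
        rw [card_filter_add_card_filter_not, card_univ]
      -- The fixing indices contribute at most `-(D + 1) * μ p`. Since `μ p ≥ 1` by integrality, one
      -- copy of `μ p` absorbs the allowed `-1`, and `D * μ p` must be paid by the moved points.
      have h5 : ((D : ℤ) + 1) ≤ #{k | ¬ a k p ≠ p} := by
        have := hdeg p
        omega
      nlinarith
  have hswap : ∑ p, ∑ k with a k p ≠ p, q (a k p) ≤ ∑ p, (D : ℤ) * q p := by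
    calc ∑ p, ∑ k with a k p ≠ p, q (a k p)
        = ∑ p, ∑ k, if a k p ≠ p then q (a k p) else 0 := by simp only [sum_filter]
      _ = ∑ k, ∑ p, if a k p ≠ p then q (a k p) else 0 := sum_comm
      -- Reindexing by `a k` turns charge received into charge sent; a point sends its `q` at most
      -- `D` times.
      _ = ∑ k, ∑ p, if a k p ≠ p then q p else 0 := by
          refine sum_congr rfl fun k _ => ?_
          rw [← Equiv.sum_comp (a k) (fun p => if a k p ≠ p then q p else 0)]
          refine sum_congr rfl fun p _ => ?_
          simp only [ne_eq, (a k).injective.eq_iff]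
      _ = ∑ p, ∑ k, if a k p ≠ p then q p else 0 := sum_comm
      _ ≤ ∑ p, (D : ℤ) * q p := by
          refine sum_le_sum fun p _ => ?_
          rw [← sum_filter, sum_const, nsmul_eq_mul]
          exact mul_le_mul_of_nonneg_right (by exact_mod_cast hdeg p) (hq0 p)
  have htot : (D : ℤ) * ∑ p, μ p ≤ (D : ℤ) * ∑ p, q p := by
    rw [mul_sum, mul_sum]
    exact (sum_le_sum fun p _ => hlocal p).trans hswap
  have : ∑ p, μ p ≤ ∑ p, q p := le_of_mul_le_mul_left htot (by exact_mod_cast hD)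
  simp only [hzq, sum_sub_distrib]
  linarith

theorem val_of_adj_apply_ne {m : ℕ} {k a : Fin (m + 1)} (h : adj m k a ≠ a) :
    (k : ℕ) = a ∨ (k : ℕ) = a + 1 := by
  cases k using Fin.cases with
  | zero => exact absurd rfl h
  | succ i =>
    by_contra! hne
    refine h (swap_apply_of_ne_of_ne ?_ ?_) <;> rintro rfl <;> simp at hne

/-- Ordered pairs of distinct positions. -/
abbrev Pos (n : ℕ) : Type := {p : Fin n × Fin n // p.1 ≠ p.2}

/-- The action of a permutation on ordered pairs of distinct positions. -/
def pairPerm {n : ℕ} (g : Perm (Fin n)) : Perm (Pos n) :=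
  (Equiv.prodCongr g g).subtypeEquiv fun _ => (not_congr g.injective.eq_iff).symm

@[simp] theorem pairPerm_coe {n : ℕ} (g : Perm (Fin n)) (p : Pos n) :
    (pairPerm g p : Fin n × Fin n) = (g p.1.1, g p.1.2) := rfl

theorem card_pos (n : ℕ) : Fintype.card (Pos n) = n * (n - 1) := by
  rw [Fintype.card_subtype]
  have : ({p | p.1 ≠ p.2} : Finset (Fin n × Fin n)) = univ.offDiag := by
    ext p; simp
  rw [this, offDiag_card, card_univ, Fintype.card_fin, Nat.mul_sub_one]

/-- Each of the two positions is moved by at most two adjacent transpositions. -/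
theorem card_pairPerm_ne_le {m : ℕ} (p : Pos (m + 1)) :
    #{k | pairPerm (adj m k) p ≠ p} ≤ 4 := by
  have hsub : ({k | pairPerm (adj m k) p ≠ p} : Finset (Fin (m + 1))).image
      (fun k : Fin (m + 1) => (k : ℕ)) ⊆
      {(p.1.1 : ℕ), (p.1.1 : ℕ) + 1, (p.1.2 : ℕ), (p.1.2 : ℕ) + 1} := by
    intro j hj
    simp only [mem_image, mem_filter, mem_univ, true_and] at hj
    obtain ⟨k, hk, rfl⟩ := hj
    have : adj m k p.1.1 ≠ p.1.1 ∨ adj m k p.1.2 ≠ p.1.2 := by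
      by_contra! h
      exact hk (Subtype.ext (Prod.ext h.1 h.2))
    simp only [mem_insert, mem_singleton]
    rcases this with h | h <;> have := val_of_adj_apply_ne h <;> tauto
  rw [← card_image_of_injective _ Fin.val_injective]
  exact (card_le_card hsub).trans card_le_four

theorem card_eq_sum_pairs {n : ℕ} {u v : Fin n} (huv : u ≠ v) (S : Finset (Perm (Fin n))) :
    #S = ∑ p : Pos n, #{σ ∈ S | σ p.1.1 = u ∧ σ p.1.2 = v} := by
  have h := card_eq_sum_card_fiberwise (s := S) (t := (univ : Finset (Pos n)))
    (f := fun σ => ⟨(σ⁻¹ u, σ⁻¹ v), fun h => huv (σ⁻¹.injective h)⟩) (by simp)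
  rw [h]
  refine sum_congr rfl fun p _ => congrArg card (filter_congr fun σ _ => ?_)
  rw [Subtype.ext_iff, Prod.ext_iff, Perm.inv_eq_iff_eq, Perm.inv_eq_iff_eq]
  exact and_congr eq_comm eq_comm

theorem exists_perm_pair {n : ℕ} (p p' : Pos n) : ∃ g : Perm (Fin n), pairPerm g p' = p := by
  refine ⟨swap (swap p'.1.1 p.1.1 p'.1.2) p.1.2 * swap p'.1.1 p.1.1, Subtype.ext (Prod.ext ?_ ?_)⟩
  · simp only [pairPerm_coe, Perm.mul_apply, swap_apply_left]
    refine swap_apply_of_ne_of_ne ?_ p.2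
    intro h
    have : swap p'.1.1 p.1.1 p'.1.1 = swap p'.1.1 p.1.1 p'.1.2 := by rw [swap_apply_left, ← h]
    exact p'.2 ((swap _ _).injective this)
  · simp

/-- Right multiplication acts transitively on pairs of positions, so the `n * (n - 1)` fibres have
equal size. -/
theorem card_pair_fiber {n : ℕ} (hn : 2 ≤ n) {u v : Fin n} (huv : u ≠ v) (p : Pos n) :
    #{σ : Perm (Fin n) | σ p.1.1 = u ∧ σ p.1.2 = v} = (n - 2).factorial := by
  have heq : ∀ p' : Pos n, #{σ : Perm (Fin n) | σ p'.1.1 = u ∧ σ p'.1.2 = v} =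
      #{σ : Perm (Fin n) | σ p.1.1 = u ∧ σ p.1.2 = v} := by
    intro p'
    obtain ⟨g, rfl⟩ := exists_perm_pair p p'
    refine card_bij' (fun σ _ => σ * g⁻¹) (fun σ _ => σ * g) ?_ ?_ ?_ ?_
    · intro σ hσ
      rw [mem_filter] at hσ ⊢
      simpa using hσ.2
    · intro σ hσ
      rw [mem_filter] at hσ ⊢
      simpa using hσ.2
    · simp
    · simp
  have h := card_eq_sum_pairs huv (univ : Finset (Perm (Fin n)))
  rw [sum_congr rfl fun p' _ => heq p', sum_const, card_univ, card_univ, card_pos,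
    Fintype.card_perm, Fintype.card_fin, smul_eq_mul] at h
  obtain ⟨k, rfl⟩ := Nat.exists_eq_add_of_le' hn
  simp only [Nat.factorial_succ, Nat.add_sub_cancel, show k + 2 - 1 = k + 1 from rfl] at h ⊢
  rw [← mul_assoc] at h
  exact (Nat.eq_of_mul_eq_mul_left (by positivity) h).symm

/-- The bound 9 is `2 * 4 + 1`, as discharging with degree 4 requires. -/
theorem maxCodeSize_prime_le {p : ℕ} (hp : p.Prime) (h9 : 9 ≤ p) :
    maxCodeSize p 3 ≤ (p - 1).factorial - (p - 1) := by
  obtain ⟨m, rfl⟩ := Nat.exists_eq_add_of_le' (show 1 ≤ p by omega)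
  refine maxCodeSize_le fun C hC => ?_
  have : Fact (m + 1).Prime := ⟨hp⟩
  obtain ⟨l, rfl⟩ := Nat.exists_eq_add_of_le' (show 1 ≤ m by omega)
  -- The prime is `l + 2`; in Wilson's `(l + 1)! = -1` the factor `l + 1` is itself `-1`.
  have hwilson : ((l.factorial : ℕ) : ZMod (l + 1 + 1)) = 1 := by
    have h := ZMod.wilsons_lemma (l + 1 + 1)
    rw [show l + 1 + 1 - 1 = l + 1 from rfl, Nat.factorial_succ, Nat.cast_mul] at h
    have h1 : ((l + 1 : ℕ) : ZMod (l + 1 + 1)) = -1 := by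
      have := ZMod.natCast_self (l + 1 + 1)
      rw [Nat.cast_succ (l + 1)] at this
      exact eq_neg_of_add_eq_zero_left this
    rw [h1, neg_one_mul, neg_inj] at h
    exact h
  have hdvd : ((l + 1 + 1 : ℕ) : ℤ) ∣ (l.factorial : ℤ) - 1 := by
    rw [← ZMod.intCast_zmod_eq_zero_iff_dvd]
    push_cast
    rw [hwilson, sub_self]
  obtain ⟨c, hc⟩ := hdvd
  have h01 : (0 : Fin (l + 1 + 1)) ≠ 1 := by simp
  set x : Pos (l + 1 + 1) → ℤ := fun p => #{π ∈ C | π p.1.1 = 0 ∧ π p.1.2 = 1} with hx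
  have hsum := sum_nonneg_of_orbit_sums (fun k => pairPerm (adj (l + 1) k)) (fun p => c - x p) 4
    (by norm_num) (by rw [Fintype.card_fin]; omega) card_pairPerm_ne_le (by
      intro p
      have h1 := sum_card_le hC fun σ => σ p.1.1 = 0 ∧ σ p.1.2 = 1
      rw [card_pair_fiber (by omega) h01, show l + 1 + 1 - 2 = l from rfl] at h1
      have h2 : ∑ k, x (pairPerm (adj (l + 1) k) p) ≤ l.factorial := by
        simp only [hx]
        exact_mod_cast h1
      rw [sum_sub_distrib, sum_const, card_univ, Fintype.card_fin, nsmul_eq_mul]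
      linarith)
  have hcard : (#C : ℤ) = ∑ p, x p := by
    rw [card_eq_sum_pairs h01 C]
    push_cast
    rfl
  rw [sum_sub_distrib, sum_const, card_univ, card_pos, nsmul_eq_mul, ← hcard] at hsum
  rw [show l + 1 + 1 - 1 = l + 1 from rfl] at hsum ⊢
  refine Nat.le_sub_of_add_le ?_
  rw [Nat.factorial_succ]
  zify
  push_cast at hsum hc
  nlinarith

/-! ### Length six: encoding and finite search -/

/-- The permutations of `{0, …, 4}` in lexicographic order, three bits per entry. -/
def wordTable : ℕ :=
  1456810550362312582867086326728129084239175258294244282977200032170120480168545607248621492813699709663692943187181176879701954509800478529269374323641818556518541776224937740254574215644943193092543506103121249523411856907845171728298868644762528084919073211227372308774929865900191436449221135391782403252545762818850902310317981015059621996901376232012956780107059116238821867625975920687606351026963291138051862921001333014545746701856472872121491144353466815256996414470303052669004207715175605815648184132155298674806547980266156344968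

/-- The lexicographic indices of the permutations of `{0, …, 4}` that arise from the `v`-th one by
swapping the entries in the positions `k` and `k + 1`, eight bits per entry. -/
def swapTable : ℕ :=
  4173597570870997689712644496989964727798847739429760415650504665301247029319163125045143583168052904856142854402886311967298637189152784047156850772634327521071541512431684265968857582732688743718341091364869992597441125315783787618996389810100607297739777480393793318856016813615336052126444526530752543095986700504066204479888431888783201849436418748361817906448088911270917983192284084298822081043417052234270760899021160882824663383258576986395365032623463005747138286954357617275791446450291274245979667849518215243748030564534642646800253157603530754168916452758668242459580711587371766765799282480475610455063795195541892230624074607396716648572860634632581132619094837933596633301502722443523459771185153760442215006590513504806467723462791069087097604229902769145684438816167628927552267376292282876305984954193869618570447629466694110320209492637621871458786874669091069963277274318891039123492070865636652654602098968258885333339723914114386078507910000213367908106597526173872333580875667568039857038533098945654225211970429746393460097570316265679351626835302830765518197274233049238092667897458505070278361331251112351286198502803879208551960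

/-- The `v`-th permutation of `{0, …, 4}`, extended by the fixed point `5`. -/
def word (v : ℕ) (j : Fin 6) : Fin 6 :=
  if j = 5 then 5 else Fin.ofNat 6 ((wordTable >>> (15 * v + 3 * j)) % 8)

/-- The index of the `v`-th permutation with the entries in the positions `k`, `k + 1` swapped. -/
def swapIndex (v k : ℕ) : ℕ :=
  Nat.mod (Nat.shiftRight swapTable (Nat.add (Nat.mul v 32) (Nat.mul k 8))) 256

/-- The ball of radius one around an index. The indices below `120` stand for the permutations
of `Fin 6` that fix `5`, and `120 + v` stands for `v` with the last two entries swapped. -/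
def ball (i : ℕ) : List ℕ :=
  bif Nat.blt i 120 then
    [i, swapIndex i 0, swapIndex i 1, swapIndex i 2, swapIndex i 3, Nat.add 120 i]
  else
    -- The ball is truncated: swapping positions 3 and 4 moves the entry 5 to position 3, and that
    -- permutation has no index.
    [i, Nat.add 120 (swapIndex (Nat.sub i 120) 0), Nat.add 120 (swapIndex (Nat.sub i 120) 1),
      Nat.add 120 (swapIndex (Nat.sub i 120) 2), Nat.sub i 120]

/-- The natural number whose binary digits are the indicator function of a list. -/
def mask : List ℕ → ℕ
  | [] => 0
  | i :: l => Nat.lor (Nat.shiftLeft 1 i) (mask l)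

/-- Application of a function to a numeral; the recursor makes the kernel evaluate the argument
first. -/
def force (n : ℕ) (f : ℕ → Bool) : Bool :=
  Nat.rec (f 0) (fun m _ => f (Nat.succ m)) n

/-- A search for a set of disjoint balls, disjoint from the set `c`, that together with `c` cover
all of the given indices, with one exception if `s` is `true`. -/
def search : List ℕ → ℕ → Bool → Bool
  | [], _, _ => true
  | v :: vs, c, s =>
    bif Nat.beq (Nat.land c (Nat.shiftLeft 1 v)) 0 then
      ((ball v).any fun i => force (mask (ball i)) fun b =>
        bif Nat.beq (Nat.land c b) 0 then force (Nat.lor c b) fun c => search vs c s else false) ||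
      (s && force (Nat.lor c (Nat.shiftLeft 1 v)) fun c => search vs c false)
    else search vs c s

/-- The indices below `120`, in an order that keeps the search short. -/
def order : List ℕ :=
  [7, 49, 31, 25, 4, 28, 42, 55, 34, 30, 54, 48, 56, 32, 29, 26, 27, 36, 3, 6, 12, 78, 8, 50,
   60, 0, 24, 62, 74, 14, 84, 72, 13, 5, 73, 16, 15, 51, 9, 10, 11, 20, 52, 18, 19, 96, 1, 58,
   38, 37, 22, 97, 79, 43, 2, 17, 57, 33, 40, 39, 102, 76, 35, 80, 103, 59, 61, 63, 53, 86, 108,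
   82, 66, 104, 85, 67, 68, 45, 41, 44, 98, 64, 75, 90, 21, 99, 23, 46, 81, 77, 100, 87, 65, 69,
   110, 83, 47, 105, 92, 106, 88, 70, 109, 91, 101, 114, 89, 71, 111, 93, 107, 116, 94, 112,
   115, 95, 113, 117, 118, 119]

/-- Index 0 is the identity: once its ball is chosen, no disjoint balls cover the permutations
fixing 5 with at most one exception. -/
theorem search_order : search order (mask (ball 0)) true = false := by
  decide +kernel

theorem force_eq (n : ℕ) (f : ℕ → Bool) : force n f = f n := by
  cases n <;> rfl

theorem testBit_shiftLeft_one (v p : ℕ) : (Nat.shiftLeft 1 v).testBit p = true ↔ p = v := by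
  rw [show Nat.shiftLeft 1 v = 2 ^ v from Nat.one_shiftLeft v, Nat.testBit_two_pow]
  simp [eq_comm]

theorem testBit_lor (a b p : ℕ) :
    (Nat.lor a b).testBit p = true ↔ a.testBit p = true ∨ b.testBit p = true := by
  rw [show Nat.lor a b = a ||| b from rfl, Nat.testBit_or, Bool.or_eq_true]

theorem testBit_mask (l : List ℕ) (p : ℕ) : (mask l).testBit p = true ↔ p ∈ l := by
  induction l with
  | nil => simp [mask]
  | cons i l ih => rw [mask, testBit_lor, testBit_shiftLeft_one, ih, List.mem_cons]

theorem beq_land_eq_true (a b : ℕ) :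
    Nat.beq (Nat.land a b) 0 = true ↔ ∀ p, a.testBit p = true → ¬ b.testBit p = true := by
  rw [show Nat.land a b = a &&& b from rfl, Nat.beq_eq]
  constructor
  · intro h p ha hb
    have := congrArg (fun n => n.testBit p) h
    simp [Nat.testBit_and, ha, hb] at this
  · intro h
    refine Nat.eq_of_testBit_eq fun p => ?_
    have := h p
    rw [Nat.testBit_and, Nat.zero_testBit]
    cases ha : a.testBit p <;> simp_all

/-! ### Correctness of the encoding -/

theorem injective_word : ∀ v : Fin 120, Function.Injective (word v) := by
  decide +kernel

/-- A number that determines the position of a word in the lexicographic order. -/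
def lexKey (f : Fin 6 → Fin 6) : ℕ :=
  ((((f 0 : ℕ) * 6 + f 1) * 6 + f 2) * 6 + f 3) * 6 + f 4

theorem lexKey_word_lt : ∀ v : Fin 119, lexKey (word v.castSucc) < lexKey (word v.succ) := by
  decide +kernel

/-- Lexicographic order reduces the check to consecutive words instead of all pairs. -/
theorem word_injective (v w : Fin 120) (h : ∀ j, word v j = word w j) : v = w := by
  have hmono : StrictMono fun v : Fin 120 => lexKey (word v) :=
    Fin.strictMono_iff_lt_succ.2 lexKey_word_lt
  refine hmono.injective ?_
  simp only [funext h]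

theorem swapIndex_lt : ∀ v : Fin 120, ∀ k : Fin 4, swapIndex v k < 120 := by
  decide +kernel

theorem word_swapIndex : ∀ v : Fin 120, ∀ k : Fin 4, ∀ j : Fin 6,
    word (swapIndex v k) j = word v (adj 5 ⟨k + 1, by omega⟩ j) := by
  decide +kernel

/-- This is why the centres that can cover `v` may be sought in `ball v`. -/
theorem ball_symm : ∀ v : Fin 120, ∀ i ∈ ball v, (v : ℕ) ∈ ball i := by
  decide +kernel

/-- The permutation of `Fin 6` that is encoded by an index below `120`. -/
noncomputable def wordPerm (v : ℕ) : Perm (Fin 6) :=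
  open Classical in
  if h : Function.Injective (word v) then
    Equiv.ofBijective (word v) (Finite.injective_iff_bijective.1 h) else 1

theorem wordPerm_apply {v : ℕ} (hv : v < 120) (j : Fin 6) : wordPerm v j = word v j := by
  rw [wordPerm, dif_pos (injective_word ⟨v, hv⟩)]
  rfl

theorem wordPerm_five {v : ℕ} (hv : v < 120) : wordPerm v 5 = 5 := by
  rw [wordPerm_apply hv]
  rfl

theorem wordPerm_swapIndex {v k : ℕ} (hv : v < 120) (hk : k < 4) :
    wordPerm (swapIndex v k) = wordPerm v * adj 5 ⟨k + 1, by omega⟩ := by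
  ext1 j
  rw [Perm.mul_apply, wordPerm_apply (swapIndex_lt ⟨v, hv⟩ ⟨k, hk⟩), wordPerm_apply hv]
  exact word_swapIndex ⟨v, hv⟩ ⟨k, hk⟩ j

/-- The permutation of `Fin 6` that is encoded by an index below `240`. -/
noncomputable def indexPerm (i : ℕ) : Perm (Fin 6) :=
  if i < 120 then wordPerm i else wordPerm (i - 120) * adj 5 5

theorem indexPerm_of_lt {i : ℕ} (hi : i < 120) : indexPerm i = wordPerm i := if_pos hi

theorem indexPerm_add (v : ℕ) : indexPerm (120 + v) = wordPerm v * adj 5 5 := by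
  rw [indexPerm, if_neg (by omega), Nat.add_sub_cancel_left]

theorem indexPerm_zero : indexPerm 0 = 1 := by
  rw [indexPerm_of_lt (by norm_num)]
  ext1 j
  rw [wordPerm_apply (by norm_num)]
  revert j
  decide +kernel

theorem ball_of_lt {i : ℕ} (hi : i < 120) : ball i =
    [i, swapIndex i 0, swapIndex i 1, swapIndex i 2, swapIndex i 3, 120 + i] := by
  have : Nat.blt i 120 = true := by rw [Nat.blt_eq]; exact hi
  rw [ball, this]
  rfl

theorem ball_add (v : ℕ) : ball (120 + v) =
    [120 + v, 120 + swapIndex v 0, 120 + swapIndex v 1, 120 + swapIndex v 2, v] := by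
  have : Nat.blt (120 + v) 120 = false := by
    rw [Bool.eq_false_iff, Ne, Nat.blt_eq]
    omega
  have h : Nat.sub (120 + v) 120 = v := Nat.add_sub_cancel_left (n := 120) (m := v)
  rw [ball, this, h]
  rfl

theorem wordPerm_injective {v w : ℕ} (hv : v < 120) (hw : w < 120)
    (h : wordPerm v = wordPerm w) : v = w := by
  have := word_injective ⟨v, hv⟩ ⟨w, hw⟩ fun j => by
    rw [← wordPerm_apply hv, ← wordPerm_apply hw, h]
  exact congrArg Fin.val this

theorem wordPerm_mul_adj_five_apply {v : ℕ} (hv : v < 120) :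
    (wordPerm v * adj 5 5) 5 ≠ 5 := by
  intro h
  have h1 := (wordPerm v).injective (h.trans (wordPerm_five hv).symm)
  revert h1
  decide

theorem indexPerm_injective {i j : ℕ} (hi : i < 240) (hj : j < 240)
    (h : indexPerm i = indexPerm j) : i = j := by
  rcases lt_or_ge i 120 with hi' | hi' <;> rcases lt_or_ge j 120 with hj' | hj'
  · rw [indexPerm_of_lt hi', indexPerm_of_lt hj'] at h
    exact wordPerm_injective hi' hj' h
  · obtain ⟨w, rfl⟩ := Nat.exists_eq_add_of_le hj'
    rw [indexPerm_of_lt hi', indexPerm_add] at h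
    exact absurd (h ▸ wordPerm_five hi') (wordPerm_mul_adj_five_apply (by omega))
  · obtain ⟨v, rfl⟩ := Nat.exists_eq_add_of_le hi'
    rw [indexPerm_of_lt hj', indexPerm_add] at h
    exact absurd (h ▸ wordPerm_five hj') (wordPerm_mul_adj_five_apply (by omega))
  · obtain ⟨v, rfl⟩ := Nat.exists_eq_add_of_le hi'
    obtain ⟨w, rfl⟩ := Nat.exists_eq_add_of_le hj'
    rw [indexPerm_add, indexPerm_add] at h
    rw [wordPerm_injective (by omega) (by omega) (mul_right_cancel h)]

theorem adj_commute : ∀ k : Fin 3,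
    adj 5 ⟨k + 1, by omega⟩ * adj 5 5 = adj 5 5 * adj 5 ⟨k + 1, by omega⟩ := by
  decide +kernel

theorem indexPerm_mem_ball {i p : ℕ} (hi : i < 240) (hp : p ∈ ball i) :
    p < 240 ∧ ∃ k, indexPerm p = indexPerm i * adj 5 k := by
  rcases lt_or_ge i 120 with hi' | hi'
  · have hs : ∀ k < 4, swapIndex i k < 240 ∧
        ∃ l, indexPerm (swapIndex i k) = indexPerm i * adj 5 l := fun k hk => by
      have := swapIndex_lt ⟨i, hi'⟩ ⟨k, hk⟩
      refine ⟨by simp only at this; omega, ⟨k + 1, by omega⟩, ?_⟩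
      rw [indexPerm_of_lt hi', indexPerm_of_lt this, wordPerm_swapIndex hi' hk]
    rw [ball_of_lt hi'] at hp
    simp only [List.mem_cons, List.not_mem_nil, or_false] at hp
    rcases hp with rfl | rfl | rfl | rfl | rfl | rfl
    · exact ⟨hi, 0, by simp⟩
    · exact hs 0 (by norm_num)
    · exact hs 1 (by norm_num)
    · exact hs 2 (by norm_num)
    · exact hs 3 (by norm_num)
    · exact ⟨by omega, 5, by rw [indexPerm_add, indexPerm_of_lt hi']⟩
  · obtain ⟨v, rfl⟩ := Nat.exists_eq_add_of_le hi'
    have hv : v < 120 := by omega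
    have hs : ∀ k < 3, 120 + swapIndex v k < 240 ∧
        ∃ l, indexPerm (120 + swapIndex v k) = indexPerm (120 + v) * adj 5 l := fun k hk => by
      have := swapIndex_lt ⟨v, hv⟩ ⟨k, by omega⟩
      refine ⟨by simp only at this; omega, ⟨k + 1, by omega⟩, ?_⟩
      rw [indexPerm_add, indexPerm_add, wordPerm_swapIndex hv (by omega), mul_assoc, mul_assoc]
      congr 1
      exact adj_commute ⟨k, hk⟩
    rw [ball_add] at hp
    simp only [List.mem_cons, List.not_mem_nil, or_false] at hp
    rcases hp with rfl | rfl | rfl | rfl | rfl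
    · exact ⟨hi, 0, by simp⟩
    · exact hs 0 (by norm_num)
    · exact hs 1 (by norm_num)
    · exact hs 2 (by norm_num)
    · exact ⟨by omega, 5, by rw [indexPerm_add, indexPerm_of_lt hv, mul_assoc, adj_mul_self,
        mul_one]⟩

theorem exists_mem_ball {v : ℕ} (hv : v < 120) (k : Fin 6) :
    ∃ i ∈ ball v, i < 240 ∧ indexPerm i = indexPerm v * adj 5 k := by
  have hs : ∀ l < 4, swapIndex v l ∈ ball v ∧ swapIndex v l < 240 ∧
      indexPerm (swapIndex v l) = indexPerm v * adj 5 (Fin.ofNat 6 (l + 1)) := fun l hl => by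
    have := swapIndex_lt ⟨v, hv⟩ ⟨l, hl⟩
    refine ⟨?_, by simp only at this; omega, ?_⟩
    · rw [ball_of_lt hv]
      interval_cases l <;> simp
    · rw [indexPerm_of_lt hv, indexPerm_of_lt this, wordPerm_swapIndex hv hl]
      congr 2
      ext
      simp only [Fin.ofNat]
      omega
  match k with
  | 0 => exact ⟨v, by rw [ball_of_lt hv]; simp, by omega, by simp⟩
  | 1 => exact ⟨_, hs 0 (by norm_num)⟩
  | 2 => exact ⟨_, hs 1 (by norm_num)⟩
  | 3 => exact ⟨_, hs 2 (by norm_num)⟩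
  | 4 => exact ⟨_, hs 3 (by norm_num)⟩
  | 5 => exact ⟨120 + v, by rw [ball_of_lt hv]; simp, by omega,
      by rw [indexPerm_add, indexPerm_of_lt hv]⟩

/-! ### Soundness of the search -/

/-- The part of the state of `search` that refers to a code `C`: the set `c` contains or avoids
each ball centred at a codeword; if `s` is `true`, it contains no uncovered index, and otherwise
all of them. -/
def Compatible (C : Finset (Perm (Fin 6))) (c : ℕ) (s : Bool) : Prop :=
  (∀ i < 240, indexPerm i ∈ C → (∀ p ∈ ball i, c.testBit p = true) ∨
    ∀ p ∈ ball i, ¬ c.testBit p = true) ∧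
  ∀ v < 120, indexPerm v ∈ uncovered C → (c.testBit v = true ↔ s = false)

theorem not_mem_ball_of_uncovered {C : Finset (Perm (Fin 6))} {v i : ℕ}
    (hu : indexPerm v ∈ uncovered C) (hi : i < 240) (hC : indexPerm i ∈ C) : v ∉ ball i := by
  intro hv
  obtain ⟨-, k, hk⟩ := indexPerm_mem_ball hi hv
  exact (mem_filter.1 hu).2 _ hC k hk.symm

/-- The code itself guides a successful branch: at each index not yet in `c`, either spend the
exception or pick the codeword covering it. -/
theorem search_eq_true {C : Finset (Perm (Fin 6))} (hC : IsPermutationCode 6 3 C)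
    (hU : #{σ ∈ uncovered C | σ 5 = 5} ≤ 1) :
    ∀ (l : List ℕ) (c : ℕ) (s : Bool), (∀ v ∈ l, v < 120) → Compatible C c s →
      search l c s = true := by
  intro l
  induction l with
  | nil => intros; rfl
  | cons v vs ih =>
    intro c s hl hc
    have hv : v < 120 := hl v List.mem_cons_self
    have hvs : ∀ w ∈ vs, w < 120 := fun w hw => hl w (List.mem_cons_of_mem v hw)
    rw [search]
    cases hcv : Nat.beq (Nat.land c (Nat.shiftLeft 1 v)) 0 with
    | false => exact ih c s hvs hc
    | true =>
      have hcv' : ¬ c.testBit v = true := fun h =>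
        (beq_land_eq_true _ _).1 hcv v h ((testBit_shiftLeft_one v v).2 rfl)
      rw [cond_true, Bool.or_eq_true]
      by_cases hu : indexPerm v ∈ uncovered C
      · right
        have hs : s = true := by
          rw [← Bool.not_eq_false]
          exact fun h => hcv' ((hc.2 v hv hu).2 h)
        subst hs
        rw [Bool.true_and, force_eq]
        refine ih _ _ hvs ⟨fun i hi hiC => ?_, fun w hw hwu => ?_⟩
        · refine (hc.1 i hi hiC).imp (fun h p hp => (testBit_lor _ _ _).2 (Or.inl (h p hp)))
            fun h p hp => ?_
          rw [testBit_lor, testBit_shiftLeft_one, not_or]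
          refine ⟨h p hp, ?_⟩
          rintro rfl
          exact not_mem_ball_of_uncovered hu hi hiC hp
        · have hfix : ∀ w < 120, indexPerm w 5 = 5 := fun w hw => by
            rw [indexPerm_of_lt hw, wordPerm_five hw]
          have := card_le_one.1 hU _ (mem_filter.2 ⟨hwu, hfix w hw⟩) _
            (mem_filter.2 ⟨hu, hfix v hv⟩)
          have := indexPerm_injective (by omega) (by omega) this
          simp only [testBit_lor, testBit_shiftLeft_one, this, or_true]
      · left
        have : ∃ π ∈ C, ∃ k, π * adj 5 k = indexPerm v := by
          by_contra! h
          exact hu (mem_filter.2 ⟨mem_univ _, h⟩)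
        obtain ⟨π, hπ, k, hk⟩ := this
        obtain ⟨i, hi, hi240, hik⟩ := exists_mem_ball hv k
        rw [← hk, mul_assoc, adj_mul_self, mul_one] at hik
        subst hik
        have hvi : v ∈ ball i := ball_symm ⟨v, hv⟩ i hi
        -- The ball meets the complement of `c` in `v`, so compatibility leaves only disjointness.
        have hdisj : ∀ p ∈ ball i, ¬ c.testBit p = true :=
          (hc.1 i hi240 hπ).resolve_left fun h => hcv' (h v hvi)
        rw [List.any_eq_true]
        refine ⟨i, hi, ?_⟩
        rw [force_eq, (beq_land_eq_true _ _).2 fun p hp hb => hdisj p ((testBit_mask _ _).1 hb) hp,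
          cond_true, force_eq]
        refine ih _ _ hvs ⟨fun j hj hjC => ?_, fun w hw hwu => ?_⟩
        · simp only [testBit_lor, testBit_mask]
          by_cases hij : i = j
          · subst hij
            exact Or.inl fun p hp => Or.inr hp
          · refine (hc.1 j hj hjC).imp (fun h p hp => Or.inl (h p hp)) fun h p hp => ?_
            rintro (hcp | hpi)
            · exact h p hp hcp
            · obtain ⟨-, a, ha⟩ := indexPerm_mem_ball hj hp
              obtain ⟨-, b, hb⟩ := indexPerm_mem_ball hi240 hpi
              exact hij (indexPerm_injective hi240 hj
                (eq_of_mul_adj_eq hC hπ hjC (hb.symm.trans ha)).1)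
        · rw [testBit_lor, testBit_mask]
          simp only [not_mem_ball_of_uncovered hwu hi240 hπ, or_false]
          exact hc.2 w hw hwu

theorem two_le_card_uncovered_of_one_mem {C : Finset (Perm (Fin 6))}
    (hC : IsPermutationCode 6 3 C) (h1 : 1 ∈ C) : 2 ≤ #{σ ∈ uncovered C | σ 5 = 5} := by
  by_contra! hlt
  have h0 : indexPerm 0 ∈ C := indexPerm_zero ▸ h1
  have h := search_eq_true hC (Nat.le_of_lt_succ hlt) order (mask (ball 0)) true (by decide) ?_
  · rw [search_order] at h
    exact absurd h (by decide)
  · refine ⟨fun j hj hjC => ?_, fun w hw hwu => ?_⟩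
    · simp only [testBit_mask]
      by_cases hij : 0 = j
      · subst hij
        exact Or.inl fun p hp => hp
      · refine Or.inr fun p hp hp0 => ?_
        obtain ⟨-, a, ha⟩ := indexPerm_mem_ball hj hp
        obtain ⟨-, b, hb⟩ := indexPerm_mem_ball (by norm_num) hp0
        exact hij (indexPerm_injective (by norm_num) hj
          (eq_of_mul_adj_eq hC h0 hjC (hb.symm.trans ha)).1)
    · rw [testBit_mask]
      simpa using not_mem_ball_of_uncovered hwu (by norm_num) h0

theorem mem_uncovered_mul_left {m : ℕ} (C : Finset (Perm (Fin (m + 1))))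
    (g σ : Perm (Fin (m + 1))) :
    g * σ ∈ uncovered (C.image (g * ·)) ↔ σ ∈ uncovered C := by
  simp only [uncovered, mem_filter, mem_univ, true_and, forall_mem_image, mul_assoc, ne_eq,
    mul_right_inj]

theorem isPermutationCode_image_mul_left {n d : ℕ} {C : Finset (Perm (Fin n))}
    (hC : IsPermutationCode n d C) (g : Perm (Fin n)) :
    IsPermutationCode n d (C.image (g * ·)) := by
  refine ⟨hC.1.image _, fun ρ hρ π hπ hne => ?_⟩
  obtain ⟨ρ, hρC, rfl⟩ := mem_image.1 hρ
  obtain ⟨π, hπC, rfl⟩ := mem_image.1 hπ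
  have hdist : kendallDist (g * ρ) (g * π) = kendallDist ρ π := by
    simp only [kendallDist, IsAdjacentProduct, mul_inv_rev, mul_assoc, inv_mul_cancel_left]
  simp only [hdist]
  exact hC.2 ρ hρC π hπC fun h => hne (by simp only [h])

/-- Left multiplication by `π⁻¹` preserves distances and uncovered permutations and takes `π` to the
identity. -/
theorem two_le_card_uncovered {C : Finset (Perm (Fin 6))} (hC : IsPermutationCode 6 3 C)
    {π : Perm (Fin 6)} (hπ : π ∈ C) : 2 ≤ #{σ ∈ uncovered C | σ 5 = π 5} := by
  have h := two_le_card_uncovered_of_one_mem (isPermutationCode_image_mul_left hC π⁻¹)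
    (mem_image.2 ⟨π, hπ, inv_mul_cancel π⟩)
  refine h.trans (card_le_card_of_injOn (π * ·) (fun σ hσ => ?_) (mul_right_injective π).injOn)
  obtain ⟨hσ, h5⟩ := mem_filter.1 hσ
  refine mem_filter.2 ⟨?_, by simp [h5]⟩
  rw [← mem_uncovered_mul_left C π⁻¹, inv_mul_cancel_left]
  exact hσ

/-! ### Length six: counting values at positions -/

theorem card_eq_sum_points {n : ℕ} (u : Fin n) (S : Finset (Perm (Fin n))) :
    #S = ∑ a, #{σ ∈ S | σ a = u} := by
  rw [card_eq_sum_card_fiberwise (s := S) (t := (univ : Finset (Fin n)))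
    (f := fun σ => σ⁻¹ u) (by simp)]
  refine sum_congr rfl fun a _ => congrArg card (filter_congr fun σ _ => ?_)
  rw [Perm.inv_eq_iff_eq]
  exact eq_comm

theorem card_eq_sum_values {n : ℕ} (a : Fin n) (S : Finset (Perm (Fin n))) :
    #S = ∑ u, #{σ ∈ S | σ a = u} :=
  card_eq_sum_card_fiberwise (by simp)

theorem card_point_fiber {m : ℕ} (a u : Fin (m + 1)) :
    #{σ : Perm (Fin (m + 1)) | σ a = u} = m.factorial := by
  have heq : ∀ b : Fin (m + 1), #{σ : Perm (Fin (m + 1)) | σ b = u} =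
      #{σ : Perm (Fin (m + 1)) | σ a = u} := fun b =>
    card_bij' (fun σ _ => σ * swap a b) (fun σ _ => σ * swap a b) (by simp) (by simp)
      (by simp [mul_assoc]) (by simp [mul_assoc])
  have h := card_eq_sum_points u (univ : Finset (Perm (Fin (m + 1))))
  rw [sum_congr rfl fun b _ => heq b, sum_const, card_univ, card_univ, Fintype.card_perm,
    Fintype.card_fin, smul_eq_mul, Nat.factorial_succ] at h
  exact (Nat.eq_of_mul_eq_mul_left (by positivity) h).symm

/-- Here `y a` stands for 20 minus the number of codewords with a fixed value at position `a`. An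
end position is fixed by five of the six ball elements, an inner one by four; the sum is `120 -
117`. -/
theorem column_bound {y : Fin 6 → ℤ} (hsum : y 0 + y 1 + y 2 + y 3 + y 4 + y 5 = 3)
    (h0 : 0 ≤ 5 * y 0 + y 1) (h1 : 0 ≤ y 0 + 4 * y 1 + y 2) (h2 : 0 ≤ y 1 + 4 * y 2 + y 3)
    (h3 : 0 ≤ y 2 + 4 * y 3 + y 4) (h4 : 0 ≤ y 3 + 4 * y 4 + y 5) (h5 : 0 ≤ y 4 + 5 * y 5) :
    0 ≤ y 5 ∧ y 5 ≤ 3 := by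
  generalize y 0 = y0 at *
  generalize y 1 = y1 at *
  generalize y 2 = y2 at *
  generalize y 3 = y3 at *
  generalize y 4 = y4 at *
  generalize y 5 = y5 at *
  refine ⟨?_, by omega⟩
  by_contra! h
  have h4l : 5 ≤ y4 := by omega
  have h4u : y4 ≤ 6 := by linarith
  have h3l : -2 ≤ y3 := by linarith
  have h3u : y3 ≤ 0 := by linarith
  interval_cases y4 <;> interval_cases y3 <;> omega

/-- The 2 in `h5` comes from the two uncovered permutations. The form `y 4 + 3 * y 5` is chosen
because its lower bound 2 becomes tight after summation over the six values. -/
theorem column_bound' {y : Fin 6 → ℤ} (hsum : y 0 + y 1 + y 2 + y 3 + y 4 + y 5 = 3)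
    (h0 : 0 ≤ 5 * y 0 + y 1) (h1 : 0 ≤ y 0 + 4 * y 1 + y 2) (h2 : 0 ≤ y 1 + 4 * y 2 + y 3)
    (h3 : 0 ≤ y 2 + 4 * y 3 + y 4) (h4 : 0 ≤ y 3 + 4 * y 4 + y 5) (h5 : 2 ≤ y 4 + 5 * y 5) :
    2 ≤ y 4 + 3 * y 5 ∧ (y 4 + 3 * y 5 = 2 → 4 * y 5 - 1 ≤ y 3) := by
  obtain ⟨hl, hu⟩ := column_bound hsum h0 h1 h2 h3 h4 (by omega)
  generalize y 0 = y0 at *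
  generalize y 1 = y1 at *
  generalize y 2 = y2 at *
  generalize y 3 = y3 at *
  generalize y 4 = y4 at *
  generalize y 5 = y5 at *
  interval_cases y5 <;> constructor <;> omega

theorem sum_point_add_uncovered {m : ℕ} {C : Finset (Perm (Fin (m + 1)))}
    (hC : IsPermutationCode (m + 1) 3 C) (a u : Fin (m + 1)) :
    ∑ k, #{π ∈ C | π (adj m k a) = u} + #{σ ∈ uncovered C | σ a = u} = m.factorial := by
  rw [← card_point_fiber a u, card_filter_eq hC fun σ => σ a = u]
  rfl

theorem adj_five_apply :
    (∀ a, adj 5 0 a = a) ∧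
    (∀ a, adj 5 1 a = ![1, 0, 2, 3, 4, 5] a) ∧ (∀ a, adj 5 2 a = ![0, 2, 1, 3, 4, 5] a) ∧
    (∀ a, adj 5 3 a = ![0, 1, 3, 2, 4, 5] a) ∧ (∀ a, adj 5 4 a = ![0, 1, 2, 4, 3, 5] a) ∧
    (∀ a, adj 5 5 a = ![0, 1, 2, 3, 5, 4] a) := by
  decide +kernel

theorem card_ne_of_perm_six {C : Finset (Perm (Fin 6))} (hC : IsPermutationCode 6 3 C) :
    #C ≠ 117 := by
  intro hcard
  set x : Fin 6 → Fin 6 → ℕ := fun u a => #{π ∈ C | π a = u} with hx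
  obtain ⟨a0, a1, a2, a3, a4, a5⟩ := adj_five_apply
  have hball : ∀ u a, ∑ k : Fin 6, x u (adj 5 k a) ≤ 120 := fun u a =>
    Nat.le.intro (sum_point_add_uncovered hC a u)
  have hlast : ∀ π ∈ C, ∑ k : Fin 6, x (π 5) (adj 5 k 5) + 2 ≤ 120 := fun π hπ =>
    (Nat.add_le_add_left (two_le_card_uncovered hC hπ) _).trans
      (sum_point_add_uncovered hC 5 (π 5)).le
  simp only [Fin.sum_univ_six, a0, a1, a2, a3, a4, a5] at hball hlast
  have hcol : ∀ u, x u 0 + x u 1 + x u 2 + x u 3 + x u 4 + x u 5 = 117 := fun u => by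
    rw [← hcard, card_eq_sum_points u C, Fin.sum_univ_six]
  have hrow : ∀ a, ∑ u, (20 - x u a : ℤ) = 3 := fun a => by
    rw [sum_sub_distrib, ← Nat.cast_sum, ← card_eq_sum_values a C, hcard]
    norm_num
  have key : ∀ u, (2 : ℤ) ≤ (20 - x u 4) + 3 * (20 - x u 5) ∧
      ((20 - x u 4) + 3 * (20 - x u 5) = (2 : ℤ) → 4 * (20 - x u 5) - 1 ≤ (20 - x u 3 : ℤ)) := by
    intro u
    have b0 := hball u 0
    have b1 := hball u 1
    have b2 := hball u 2
    have b3 := hball u 3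
    have b4 := hball u 4
    have b5 := hball u 5
    have hs := hcol u
    simp [Matrix.cons_val] at b0 b1 b2 b3 b4 b5
    have hu := (column_bound (y := fun a => (20 - x u a : ℤ)) (by omega)
      (by omega) (by omega) (by omega) (by omega)
      (by omega) (by omega)).2
    -- A deficiency of at most 3 leaves at least 17 codewords with last entry `u`, so the search
    -- result applies to every `u`.
    have hpos : 0 < x u 5 := by
      omega
    obtain ⟨π, hπ⟩ := Finset.card_pos.1 hpos
    obtain ⟨hπC, rfl⟩ := mem_filter.1 hπ
    have h2 := hlast π hπC
    simp [Matrix.cons_val] at h2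
    exact column_bound' (y := fun a => (20 - x (π 5) a : ℤ)) (by omega)
      (by omega) (by omega) (by omega) (by omega)
      (by omega) (by omega)
  have h3 := hrow 3
  have h4 := hrow 4
  have h5 := hrow 5
  simp only [Fin.sum_univ_six] at h3 h4 h5
  have k0 := key 0
  have k1 := key 1
  have k2 := key 2
  have k3 := key 3
  have k4 := key 4
  have k5 := key 5
  -- Over all `u` the forms sum to `3 + 3 * 3 = 6 * 2`, so each equals 2. The implications then sum
  -- to `4 * 3 - 6 ≤ 3`, which is false.
  omega

/-! ### Length seven: counting by position and sign -/

theorem right_bounds_of_middle_nonneg {s0 s1 s2 s3 s4 s5 s6 : ℤ}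
    (hsum : s0 + s1 + s2 + s3 + s4 + s5 + s6 = -3) (hs : 0 ≤ s3)
    (h0 : -6 ≤ 6 * s0 + s1) (h1 : -6 ≤ s0 + 5 * s1 + s2) (h2 : -6 ≤ s1 + 5 * s2 + s3)
    (h3 : -6 ≤ s2 + 5 * s3 + s4) (h4 : -6 ≤ s3 + 5 * s4 + s5) (h5 : -6 ≤ s4 + 5 * s5 + s6)
    (h6 : -6 ≤ s5 + 6 * s6) :
    (-1 ≤ s4 ∧ s4 ≤ 0) ∧ (-1 ≤ s5 ∧ s5 ≤ 1) ∧ (-1 ≤ s6 ∧ s6 ≤ 1) := by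
  refine ⟨⟨?_, ?_⟩, ⟨?_, ?_⟩, ?_, ?_⟩ <;> omega

/-- The system is invariant under reversing the positions, so the right-hand bounds hold on the left
too. This confines a counterexample to `middle_neg` to a small box. -/
theorem bounds_of_middle_nonneg {s0 s1 s2 s3 s4 s5 s6 : ℤ}
    (hsum : s0 + s1 + s2 + s3 + s4 + s5 + s6 = -3) (hs : 0 ≤ s3)
    (h0 : -6 ≤ 6 * s0 + s1) (h1 : -6 ≤ s0 + 5 * s1 + s2) (h2 : -6 ≤ s1 + 5 * s2 + s3)
    (h3 : -6 ≤ s2 + 5 * s3 + s4) (h4 : -6 ≤ s3 + 5 * s4 + s5) (h5 : -6 ≤ s4 + 5 * s5 + s6)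
    (h6 : -6 ≤ s5 + 6 * s6) :
    (-1 ≤ s0 ∧ s0 ≤ 1) ∧ (-1 ≤ s1 ∧ s1 ≤ 1) ∧ (-1 ≤ s2 ∧ s2 ≤ 0) ∧ s3 ≤ 1 ∧
      (-1 ≤ s4 ∧ s4 ≤ 0) ∧ (-1 ≤ s5 ∧ s5 ≤ 1) ∧ (-1 ≤ s6 ∧ s6 ≤ 1) := by
  obtain ⟨b4, b5, b6⟩ := right_bounds_of_middle_nonneg hsum hs h0 h1 h2 h3 h4 h5 h6
  obtain ⟨b2, b1, b0⟩ := right_bounds_of_middle_nonneg (s0 := s6) (s1 := s5) (s2 := s4)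
    (s3 := s3) (s4 := s2) (s5 := s1) (s6 := s0) (by linarith) hs (by linarith) (by linarith)
    (by linarith) (by linarith) (by linarith) (by linarith) (by linarith)
  refine ⟨b0, b1, b2, ?_, b4, b5, b6⟩
  clear h1 h2 h3 h4 h5
  omega

/-- Integer lemma on positions of a value, separately for even (`p`) and odd (`m`) codewords. -/
theorem middle_neg {p0 p1 p2 p3 p4 p5 p6 m0 m1 m2 m3 m4 m5 m6 : ℤ}
    (hsum : p0 + p1 + p2 + p3 + p4 + p5 + p6 + (m0 + m1 + m2 + m3 + m4 + m5 + m6) = -3)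
    (p0' : -3 ≤ p0 + 5 * m0 + m1) (p1' : -3 ≤ p1 + m0 + 4 * m1 + m2)
    (p2' : -3 ≤ p2 + m1 + 4 * m2 + m3) (p3' : -3 ≤ p3 + m2 + 4 * m3 + m4)
    (p4' : -3 ≤ p4 + m3 + 4 * m4 + m5) (p5' : -3 ≤ p5 + m4 + 4 * m5 + m6)
    (p6' : -3 ≤ p6 + m5 + 5 * m6)
    (m0' : -3 ≤ m0 + 5 * p0 + p1) (m1' : -3 ≤ m1 + p0 + 4 * p1 + p2)
    (m2' : -3 ≤ m2 + p1 + 4 * p2 + p3) (m3' : -3 ≤ m3 + p2 + 4 * p3 + p4)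
    (m4' : -3 ≤ m4 + p3 + 4 * p4 + p5) (m5' : -3 ≤ m5 + p4 + 4 * p5 + p6)
    (m6' : -3 ≤ m6 + p5 + 5 * p6) : p3 + m3 ≤ -1 := by
  by_contra! hs
  -- Adding the inequalities of the two signs gives a system in the sums `s` alone.
  obtain ⟨s0, rfl⟩ : ∃ s, m0 = s - p0 := ⟨_, (add_sub_cancel_left p0 m0).symm⟩
  obtain ⟨s1, rfl⟩ : ∃ s, m1 = s - p1 := ⟨_, (add_sub_cancel_left p1 m1).symm⟩
  obtain ⟨s2, rfl⟩ : ∃ s, m2 = s - p2 := ⟨_, (add_sub_cancel_left p2 m2).symm⟩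
  obtain ⟨s3, rfl⟩ : ∃ s, m3 = s - p3 := ⟨_, (add_sub_cancel_left p3 m3).symm⟩
  obtain ⟨s4, rfl⟩ : ∃ s, m4 = s - p4 := ⟨_, (add_sub_cancel_left p4 m4).symm⟩
  obtain ⟨s5, rfl⟩ : ∃ s, m5 = s - p5 := ⟨_, (add_sub_cancel_left p5 m5).symm⟩
  obtain ⟨s6, rfl⟩ : ∃ s, m6 = s - p6 := ⟨_, (add_sub_cancel_left p6 m6).symm⟩
  have t : s0 + s1 + s2 + s3 + s4 + s5 + s6 = -3 := by linarith
  have t3 : 0 ≤ s3 := by linarith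
  have h0 : -6 ≤ 6 * s0 + s1 := by linarith
  have h1 : -6 ≤ s0 + 5 * s1 + s2 := by linarith
  have h2 : -6 ≤ s1 + 5 * s2 + s3 := by linarith
  have h3 : -6 ≤ s2 + 5 * s3 + s4 := by linarith
  have h4 : -6 ≤ s3 + 5 * s4 + s5 := by linarith
  have h5 : -6 ≤ s4 + 5 * s5 + s6 := by linarith
  have h6 : -6 ≤ s5 + 6 * s6 := by linarith
  obtain ⟨⟨l0, u0⟩, ⟨l1, u1⟩, ⟨l2, u2⟩, u3, ⟨l4, u4⟩, ⟨l5, u5⟩, ⟨l6, u6⟩⟩ :=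
    bounds_of_middle_nonneg t t3 h0 h1 h2 h3 h4 h5 h6
  clear hsum hs
  -- Most cases already contradict the system for `s`; the signed inequalities serve only the
  -- survivors, with a split on `p4` and `p2` near 0 where needed.
  interval_cases s3 <;> interval_cases s2 <;> interval_cases s4 <;>
    first
    | (clear p0' p1' p2' p3' p4' p5' p6' m0' m1' m2' m3' m4' m5' m6'; omega)
    | (interval_cases s1 <;> interval_cases s5 <;>
        first
        | (clear p0' p1' p2' p3' p4' p5' p6' m0' m1' m2' m3' m4' m5' m6'; omega)
        | (interval_cases s0 <;>
            first
            | (clear p0' p1' p2' p3' p4' p5' p6' m0' m1' m2' m3' m4' m5' m6'; omega)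
            | (obtain rfl : s6 = _ := eq_sub_of_add_eq' t
               first
               | omega
               | (obtain h | rfl | rfl | rfl | h :
                     p4 ≤ -2 ∨ p4 = -1 ∨ p4 = 0 ∨ p4 = 1 ∨ 2 ≤ p4 := by omega
                  all_goals first
                  | omega
                  | (obtain h | rfl | rfl | rfl | h :
                        p2 ≤ -2 ∨ p2 = -1 ∨ p2 = 0 ∨ p2 = 1 ∨ 2 ≤ p2 := by omega
                     all_goals omega)))))

theorem adj_six_apply :
    (∀ a, adj 6 0 a = a) ∧
    (∀ a, adj 6 1 a = ![1, 0, 2, 3, 4, 5, 6] a) ∧ (∀ a, adj 6 2 a = ![0, 2, 1, 3, 4, 5, 6] a) ∧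
    (∀ a, adj 6 3 a = ![0, 1, 3, 2, 4, 5, 6] a) ∧ (∀ a, adj 6 4 a = ![0, 1, 2, 4, 3, 5, 6] a) ∧
    (∀ a, adj 6 5 a = ![0, 1, 2, 3, 5, 4, 6] a) ∧
    (∀ a, adj 6 6 a = ![0, 1, 2, 3, 4, 6, 5] a) := by
  decide +kernel

theorem sign_adj_succ {m : ℕ} (i : Fin m) : Perm.sign (adj m i.succ) = -1 := by
  rw [adj_succ, Perm.sign_swap i.castSucc_lt_succ.ne]

theorem card_sign_fiber_add {n : ℕ} (S : Finset (Perm (Fin n))) (a u : Fin n) (ε : ℤˣ) :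
    #{σ ∈ S | σ a = u ∧ Perm.sign σ = ε} + #{σ ∈ S | σ a = u ∧ Perm.sign σ = -ε} =
      #{σ ∈ S | σ a = u} := by
  rw [← card_filter_add_card_filter_not (s := {σ ∈ S | σ a = u}) fun σ => Perm.sign σ = ε,
    filter_filter, filter_filter]
  congr 2
  refine filter_congr fun σ _ => and_congr_right fun _ => ?_
  rcases Int.units_eq_one_or ε with rfl | rfl <;>
    rcases Int.units_eq_one_or (Perm.sign σ) with h | h <;> rw [h] <;> decide

/-- Swapping two positions other than `a` exchanges the signs, so each gets half of `6!`. -/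
theorem card_sign_fiber (a u : Fin 7) (ε : ℤˣ) :
    #{σ : Perm (Fin 7) | σ a = u ∧ Perm.sign σ = ε} = 360 := by
  obtain ⟨c, d, hcd, hc, hd⟩ : ∃ c d : Fin 7, c ≠ d ∧ a ≠ c ∧ a ≠ d := by
    revert a; decide
  have h : #{σ : Perm (Fin 7) | σ a = u ∧ Perm.sign σ = ε} =
      #{σ : Perm (Fin 7) | σ a = u ∧ Perm.sign σ = -ε} := by
    refine card_equiv (Equiv.mulRight (swap c d)) fun σ => ?_
    simp [Perm.sign_mul, Perm.sign_swap hcd, swap_apply_of_ne_of_ne hc hd]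
  have := card_sign_fiber_add univ a u ε
  rw [← h, card_point_fiber] at this
  norm_num [Nat.factorial] at this
  omega

theorem sum_sign_fiber_le {C : Finset (Perm (Fin 7))} (hC : IsPermutationCode 7 3 C)
    (a u : Fin 7) (ε : ℤˣ) :
    #{π ∈ C | π a = u ∧ Perm.sign π = ε} +
      ∑ k : Fin 6, #{π ∈ C | π (adj 6 k.succ a) = u ∧ Perm.sign π = -ε} ≤ 360 := by
  have h := sum_card_le hC fun σ => σ a = u ∧ Perm.sign σ = ε
  rw [card_sign_fiber, Fin.sum_univ_succ] at h
  simpa only [adj_zero, mul_one, Perm.mul_apply, Perm.sign_mul, sign_adj_succ, mul_neg_one,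
    neg_eq_iff_eq_neg] using h

theorem card_ne_of_perm_seven {C : Finset (Perm (Fin 7))} (hC : IsPermutationCode 7 3 C) :
    #C ≠ 717 := by
  intro hcard
  set x : ℤˣ → Fin 7 → Fin 7 → ℕ := fun ε u a => #{π ∈ C | π a = u ∧ Perm.sign π = ε} with hx
  obtain ⟨-, a1, a2, a3, a4, a5, a6⟩ := adj_six_apply
  have hball : ∀ ε u a, x ε u a + ∑ k : Fin 6, x (-ε) u (adj 6 k.succ a) ≤ 360 := fun ε u a =>
    sum_sign_fiber_le hC a u ε
  have hadd : ∀ u a, x 1 u a + x (-1) u a = #{π ∈ C | π a = u} := fun u a =>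
    card_sign_fiber_add C a u 1
  have hcol : ∀ u, ∑ a, (x 1 u a + x (-1) u a) = 717 := fun u => by
    simp only [hadd, ← card_eq_sum_points u C, hcard]
  have hrow : ∑ u, (x 1 u 3 + x (-1) u 3) = 717 := by
    simp only [hadd, ← card_eq_sum_values 3 C, hcard]
  have key : ∀ u, 103 ≤ x 1 u 3 + x (-1) u 3 := by
    intro u
    have hs := hcol u
    have b := hball 1 u
    have c := hball (-1) u
    have f1 : (0 : Fin 6).succ = 1 := rfl
    have f2 : (1 : Fin 6).succ = 2 := rfl
    have f3 : (2 : Fin 6).succ = 3 := rfl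
    have f4 : (3 : Fin 6).succ = 4 := rfl
    have f5 : (4 : Fin 6).succ = 5 := rfl
    have f6 : (5 : Fin 6).succ = 6 := rfl
    simp only [Fin.sum_univ_six, f1, f2, f3, f4, f5, f6, a1, a2, a3, a4, a5, a6, neg_neg] at b c
    have b0 := b 0
    have b1 := b 1
    have b2 := b 2
    have b3 := b 3
    have b4 := b 4
    have b5 := b 5
    have b6 := b 6
    have c0 := c 0
    have c1 := c 1
    have c2 := c 2
    have c3 := c 3
    have c4 := c 4
    have c5 := c 5
    have c6 := c 6
    clear b c
    clear_value x
    simp [Matrix.cons_val, Fin.sum_univ_seven] at hs b0 b1 b2 b3 b4 b5 b6 c0 c1 c2 c3 c4 c5 c6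
    zify at hs b0 b1 b2 b3 b4 b5 b6 c0 c1 c2 c3 c4 c5 c6
    -- With base 51 the ball slack is `7 * 51 - 360 = -3` and the total is `14 * 51 - 717 = -3`.
    have := middle_neg (p0 := 51 - x 1 u 0) (p1 := 51 - x 1 u 1) (p2 := 51 - x 1 u 2)
      (p3 := 51 - x 1 u 3) (p4 := 51 - x 1 u 4) (p5 := 51 - x 1 u 5) (p6 := 51 - x 1 u 6)
      (m0 := 51 - x (-1) u 0) (m1 := 51 - x (-1) u 1) (m2 := 51 - x (-1) u 2)
      (m3 := 51 - x (-1) u 3) (m4 := 51 - x (-1) u 4) (m5 := 51 - x (-1) u 5)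
      (m6 := 51 - x (-1) u 6)
      (by linarith) (by linarith) (by linarith) (by linarith) (by linarith)
      (by linarith) (by linarith) (by linarith) (by linarith) (by linarith)
      (by linarith) (by linarith) (by linarith) (by linarith) (by linarith)
    zify
    linarith
  have := sum_le_sum fun u (_ : u ∈ univ) => key u
  rw [hrow] at this
  simp at this

end KendallCode

theorem mainTheorem4 :
    maxCodeSize 6 3 ≤ 116 ∧
    maxCodeSize 7 3 ≤ 716 ∧
    maxCodeSize 11 3 ≤ Nat.factorial 10 - 10 ∧
    maxCodeSize 13 3 ≤ Nat.factorial 12 - 12 ∧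
    maxCodeSize 17 3 ≤ Nat.factorial 16 - 5 :=
  ⟨KendallCode.maxCodeSize_le_of_ne fun _ hC => KendallCode.card_ne_of_perm_six hC,
    KendallCode.maxCodeSize_le_of_ne fun _ hC => KendallCode.card_ne_of_perm_seven hC,
    KendallCode.maxCodeSize_prime_le (by norm_num) (by norm_num),
    KendallCode.maxCodeSize_prime_le (by norm_num) (by norm_num),
    -- The prime bound gives the stronger `16! - 16`.
    (KendallCode.maxCodeSize_prime_le (by norm_num) (by norm_num)).trans
      (Nat.sub_le_sub_left (by norm_num) _)⟩
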